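/- \textbf{CFI structures.} Let $q$ be a prime power, $G$ a finite simple graph whose vertex set is linearly ordered by $<$, and $g\colon E(G)\to\mathbb{Z}_q=\mathbb{Z}/q\mathbb{Z}$. For a vertex $x$ with neighbourhood $N(x)$ let $A_x=\{\mathbf a\in\mathbb{Z}_q^{N(x)} : \sum_{y\in N(x)}\mathbf a(y)=0\}$. The relational structure $\mathbf{CFI}_q(G,g)$ has as universe the disjoint union $\bigsqcup_x A_x$ and the relations $\prec,R_I,R_C,R_{E,c}$ ($c\in\mathbb{Z}_q$): $\mathbf a\prec\mathbf b$ iff $\mathbf a\in A_x$, $\mathbf b\in A_y$ with $x<y$; $R_I$ (resp. $R_C$) consists of the triples $(\mathbf a,\mathbf b,\mathbf c)$ with $\mathbf a,\mathbf b\in A_x$, $\mathbf c\in A_y$ for some adjacent $x,y$ and $\mathbf a(y)=\mathbf b(y)$ (resp. $\mathbf a(y)=\mathbf b(y)+1$); $R_{E,c}$ consists of the pairs $(\mathbf a,\mathbf b)$ with $\mathbf a\in A_x$, $\mathbf b\in A_y$ for some adjacent $x,y$ and $\mathbf a(y)+\mathbf b(x)=c+g(\{x,y\})$. The structure has the \emph{CFI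 property} if $\sum g:=\sum_{e\in E(G)}g(e)=0$. \textbf{Cohomological $k$-Weisfeiler--Leman equivalence.} For finite relational structures $A,B$ over the same signature let $\mathcal I_k(A,B)$ be the set of injective partial functions $s\colon A\rightharpoonup B$ with $|\mathrm{dom}(s)|\le k$ that preserve and reflect all related tuples; a subpresheaf of $\mathcal I_k(A,B)$ is a subset closed under restriction. For a set $S$ of such maps, a $\mathbb{Z}$-linear global section of $S$ is a family $(r_U)$, indexed by the sets $U\subseteq A$ with $|U|\le k$, of formal $\mathbb{Z}$-linear combinations $r_U$ of maps in $S$ with domain $U$ such that $r_U|_{U'}=r_{U'}$ whenever $U'\subseteq U$; the map $s\in S$ is $\mathbb{Z}$-extendable in $S$ if some such family has $r_{\mathrm{dom}(s)}=s$. It is $\mathbb{Z}$-bi-extendable in $S$ if moreover $s^{-1}$ is $\mathbb{Z}$-extendable in $S^{-1}=\{t^{-1}: t\in S\}$. It has the bijective forth property in $S$ if $|\mathrm{dom}(s)|<k$ implies that there is a bijection $b\colon A\to B$ with $s\cup\{(a,b(a))\}\in S$ for all $a\in A$. Let $S^{\mathbb{Z}\#}$ be the largest subpresheaf of $S$ all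 of whose elements have the bijective forth property in $S$ and are $\mathbb{Z}$-bi-extendable in $S$. Write $A\equiv^{\mathbb{Z}}_k B$ if the greatest fixpoint of $S\mapsto S^{\mathbb{Z}\#}$ among the subpresheaves of $\mathcal I_k(A,B)$ is non-empty. \textbf{Theorem.} There is a fixed $k$ such that for every prime power $q$: (1) for every finite linearly ordered graph $G$ and all $g,h\colon E(G)\to\mathbb{Z}_q$ with $\sum g=0$, $$\mathbf{CFI}_q(G,g)\equiv^{\mathbb{Z}}_k\mathbf{CFI}_q(G,h)\iff\mathbf{CFI}_q(G,g)\cong\mathbf{CFI}_q(G,h);$$ (2) $\equiv^{\mathbb{Z}}_k$ separates positive and negative instances of the CFI property: for all finite linearly ordered graphs $G,H$ and all $g\colon E(G)\to\mathbb{Z}_q$, $h\colon E(H)\to\mathbb{Z}_q$ with $\sum g=0$ and $\sum h\neq 0$, $\mathbf{CFI}_q(G,g)\not\equiv^{\mathbb{Z}}_k\mathbf{CFI}_q(H,h)$. In particular this holds with $q=2^m$ for the structures $\mathbf{CFI}_{2^m}(G,g)$ over any class of finite linearly ordered graphs. -/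

import Mathlib

universe u

namespace CohomWL

open FirstOrder

/-! ### Partial functions, local isomorphisms and their presheaves

A finite partial function `A ⇀ B` is given by its graph, a finite subset of `A × B`.
For functional graphs the order `⊆` on `Finset (A × B)` is the restriction order, so a family of
partial functions that is closed under restriction is a `LowerSet (Finset (A × B))`; its sections
over `U` are its members with domain `U`, and the restriction maps are `restrict`. -/

section LocalSections

variable {A B : Type*}

open Classical in
/-- The domain of a partial function, given by its graph. -/
noncomputable def dom (s : Finset (A × B)) : Finset A := s.image Prod.fst

open Classical in
/-- The restriction of a partial function to `U`. -/
noncomputable def restrict (U : Finset A) (s : Finset (A × B)) : Finset (A × B) :=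
  s.filter fun p => p.1 ∈ U

open Classical in
/-- `s ∪ {(a, b)}`. -/
noncomputable def extend (s : Finset (A × B)) (a : A) (b : B) : Finset (A × B) :=
  insert (a, b) s

/-- The inverse (transposed graph) of a partial function. -/
def inv (s : Finset (A × B)) : Finset (B × A) := s.map (Equiv.prodComm A B).toEmbedding

/-- `s` is a `k`-local isomorphism between the relational structures `A` and `B`: it is the graph
of an injective partial function, its domain has at most `k` elements, and it preserves and
reflects all related tuples. -/
structure IsLocalIso (L : Language) [L.IsRelational] [L.Structure A] [L.Structure B]
    (k : ℕ) (s : Finset (A × B)) : Prop where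
  card_le : (dom s).card ≤ k
  functional : ∀ p ∈ s, ∀ p' ∈ s, p.1 = p'.1 → p.2 = p'.2
  injective : ∀ p ∈ s, ∀ p' ∈ s, p.2 = p'.2 → p.1 = p'.1
  map_rel : ∀ {n : ℕ} (R : L.Relations n) (a : Fin n → A) (b : Fin n → B),
    (∀ i, (a i, b i) ∈ s) →
      (Language.Structure.RelMap R a ↔ Language.Structure.RelMap R b)

/-- The presheaf `𝓘ₖ(A, B)` of all `k`-local isomorphisms. -/
def localIso (L : Language) [L.IsRelational] (k : ℕ) (A B : Type*) [L.Structure A]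
    [L.Structure B] : LowerSet (Finset (A × B)) where
  carrier := {s | IsLocalIso L k s}
  lower' := by
    classical
    intro s t hts hs
    have hts : t ⊆ s := hts
    exact
      { card_le := (Finset.card_le_card (Finset.image_subset_image hts)).trans hs.card_le
        functional := fun p hp p' hp' => hs.functional p (hts hp) p' (hts hp')
        injective := fun p hp p' hp' => hs.injective p (hts hp) p' (hts hp')
        map_rel := fun R a b h => hs.map_rel R a b fun i => hts (h i) }

/-- The bijective forth property of `s` in `S` (a condition only when `|dom s| < k`). -/
def BijForth (k : ℕ) (S : Set (Finset (A × B))) (s : Finset (A × B)) : Prop :=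
  (dom s).card < k → ∃ b : A ≃ B, ∀ a : A, extend s a (b a) ∈ S

/-- `r` is a `ℤ`-linear global section of `S` over the subsets of `A` with at most `k` elements:
`r U` is a formal `ℤ`-linear combination of members of `S` with domain `U`, and the `r U` are
compatible with restriction (extended linearly). Values of `r` on larger sets play no role. -/
structure IsGlobalSection (k : ℕ) (S : Set (Finset (A × B)))
    (r : Finset A → (Finset (A × B) →₀ ℤ)) : Prop where
  mem : ∀ U : Finset A, U.card ≤ k → ∀ t ∈ (r U).support, t ∈ S ∧ dom t = U
  compat : ∀ U' U : Finset A, U' ⊆ U → U.card ≤ k → (r U).mapDomain (restrict U') = r U'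

/-- `s` is `ℤ`-extendable in `S`. -/
def ZExt (k : ℕ) (S : Set (Finset (A × B))) (s : Finset (A × B)) : Prop :=
  ∃ r : Finset A → (Finset (A × B) →₀ ℤ),
    IsGlobalSection k S r ∧ r (dom s) = Finsupp.single s 1

/-- `s` is `ℤ`-bi-extendable in `S`: `s` is `ℤ`-extendable in `S`, and `s⁻¹` is `ℤ`-extendable in
`S⁻¹ = {t⁻¹ | t ∈ S}`. -/
def ZBiExt (k : ℕ) (S : Set (Finset (A × B))) (s : Finset (A × B)) : Prop :=
  ZExt k S s ∧ ZExt k (inv '' S) (inv s)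

/-- The largest subpresheaf of `S` all of whose members have the bijective forth property in `S`
and are `ℤ`-bi-extendable in `S`. -/
def refine (k : ℕ) (S : LowerSet (Finset (A × B))) : LowerSet (Finset (A × B)) :=
  sSup {T | T ≤ S ∧ ∀ s ∈ T, BijForth k (S : Set _) s ∧ ZBiExt k (S : Set _) s}

/-- The greatest fixpoint of `refine k` among the subpresheaves of `S`. -/
def greatestFixpoint (k : ℕ) (S : LowerSet (Finset (A × B))) : LowerSet (Finset (A × B)) :=
  sSup {T | T ≤ S ∧ refine k T = T}

theorem refine_le (k : ℕ) (S : LowerSet (Finset (A × B))) : refine k S ≤ S :=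
  sSup_le fun _ hT => hT.1

theorem ZExt.mono {k : ℕ} {S S' : Set (Finset (A × B))} (h : S ⊆ S') {s : Finset (A × B)} :
    ZExt k S s → ZExt k S' s := fun ⟨r, hr, hs⟩ =>
  ⟨r, ⟨fun U hU t ht => ⟨h (hr.mem U hU t ht).1, (hr.mem U hU t ht).2⟩, hr.compat⟩, hs⟩

theorem refine_mono (k : ℕ) : Monotone (refine (A := A) (B := B) k) := by
  intro S S' h
  refine sSup_le_sSup fun T hT => ⟨hT.1.trans h, fun s hs => ⟨fun hc => ?_, ?_, ?_⟩⟩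
  · obtain ⟨b, hb⟩ := (hT.2 s hs).1 hc
    exact ⟨b, fun a => h (hb a)⟩
  · exact (hT.2 s hs).2.1.mono h
  · exact (hT.2 s hs).2.2.mono (Set.image_mono h)

/-- `greatestFixpoint k S` is indeed the greatest fixpoint of `refine k` below `S`. -/
theorem isGreatest_greatestFixpoint (k : ℕ) (S : LowerSet (Finset (A × B))) :
    IsGreatest {T | T ≤ S ∧ refine k T = T} (greatestFixpoint k S) :=
  ⟨⟨sSup_le fun _ hT => hT.1, le_antisymm (refine_le k _) (sSup_le fun _ hT =>
    hT.2.ge.trans (refine_mono k (le_sSup hT)))⟩, fun _ hT => le_sSup hT⟩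

/-- Cohomological `k`-equivalence `A ≡ᶻₖ B`: the cohomological `k`-Weisfeiler-Leman algorithm
accepts `(A, B)`, that is, the greatest fixpoint starting from `𝓘ₖ(A, B)` is non-empty. -/
def CohomEquiv (L : Language) [L.IsRelational] (k : ℕ) (A B : Type*) [L.Structure A]
    [L.Structure B] : Prop :=
  ∃ s, s ∈ greatestFixpoint k (localIso L k A B)

end LocalSections

/-! ### CFI structures -/

/-- The relation symbols `≺`, `R_I`, `R_C` and `R_{E,c}` for `c ∈ ℤ_q`. -/
inductive CFIRel (q : ℕ) : ℕ → Type
  | prec : CFIRel q 2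
  | I : CFIRel q 3
  | C : CFIRel q 3
  | E (c : ZMod q) : CFIRel q 2

/-- The relational signature of the structures `CFI_q(G, g)`. -/
def cfiLanguage (q : ℕ) : Language := ⟨fun _ => Empty, CFIRel q⟩

instance (q : ℕ) : (cfiLanguage q).IsRelational := fun _ => inferInstanceAs (IsEmpty Empty)

section CFI

variable {V : Type*} [Fintype V] (q : ℕ) (G : SimpleGraph V) [DecidableRel G.Adj]

/-- The vertex gadget `A_x`: functions `N(x) → ℤ_q` with sum `0`. -/
def Gadget (x : V) : Type _ := {a : G.neighborSet x → ZMod q // ∑ y, a y = 0}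

/-- The universe of `CFI_q(G, g)`, the disjoint union of the gadgets; the twist `g` is recorded in
the type because the relations depend on it. -/
structure CFI (g : G.edgeSet → ZMod q) where
  /-- the vertex of `G` to whose gadget the element belongs -/
  vertex : V
  /-- the element of the gadget -/
  val : Gadget q G vertex

/-- The relations of `CFI_q(G, g)`. Unions over edges `{x, y}` run over both orientations. -/
instance [LinearOrder V] (g : G.edgeSet → ZMod q) :
    (cfiLanguage q).Structure (CFI q G g) where
  funMap := fun f => nomatch f
  RelMap := fun R => match R with
    | .prec => fun v => (v 0).vertex < (v 1).vertex
    | .I => fun v => ∃ (x y : V) (hxy : G.Adj x y) (a b : Gadget q G x) (c : Gadget q G y),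
        v = ![⟨x, a⟩, ⟨x, b⟩, ⟨y, c⟩] ∧ a.1 ⟨y, hxy⟩ = b.1 ⟨y, hxy⟩
    | .C => fun v => ∃ (x y : V) (hxy : G.Adj x y) (a b : Gadget q G x) (c : Gadget q G y),
        v = ![⟨x, a⟩, ⟨x, b⟩, ⟨y, c⟩] ∧ a.1 ⟨y, hxy⟩ = b.1 ⟨y, hxy⟩ + 1
    | .E c => fun v => ∃ (x y : V) (hxy : G.Adj x y) (a : Gadget q G x) (b : Gadget q G y),
        v = ![⟨x, a⟩, ⟨y, b⟩] ∧
          a.1 ⟨y, hxy⟩ + b.1 ⟨x, hxy.symm⟩ = c + g ⟨s(x, y), hxy⟩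

end CFI

end CohomWL

/-!
The value `k = 2` works, and the argument does not use that `q` is a prime power beyond `q ≠ 0`.

*An isomorphism gives equivalence* over any relational language: the restrictions of the isomorphism
to sets of at most `k` elements form a fixpoint, where the required bijections are the isomorphism
itself and the required global sections are concentrated on its restrictions
(`cohomEquiv_of_equiv`).

*Equivalence gives a potential.* Let `S` be a non-empty fixpoint for `CFI q G g` and `CFI q H h`.
The bijective forth property at singletons shows that a pair in `S` relates elements having equally
many `≺`-predecessors. Since all gadgets are non-empty, this yields an isomorphism `φ` of ordered
graphs such that all maps in `S` send the gadget of `x` to the gadget of `φ x`. For every vertex `x`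
take the zero element of its gadget. A map in `S` defined at the zero elements of two adjacent
vertices `x`, `y`, with images `b`, `d`, satisfies the linear equations `∑ b = 0` and
`b (φ y) + d (φ x) = h {φ x, φ y} - g {x, y}`. A global section `r` that restricts to the empty map
has total mass `1` on each set of at most two elements, so averaging these affine equations with
the integer weights `r` gives one globally consistent solution: a function `t` on the darts of `G`
with vanishing vertex sums and `t x y + t y x = h {φ x, φ y} - g {x, y}`
(`exists_potential_of_cohomEquiv`).

Summing over all darts gives `∑ h = ∑ g`, which is the second part; on one and the same graph `φ`
is the identity and translation by `t` is an isomorphism (`equivOfPotential`), which is the first.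
-/

namespace CohomWL

open FirstOrder

/-! ### Isomorphic structures are cohomologically equivalent -/

section OfEquiv

variable {A B : Type*}

theorem mem_dom {s : Finset (A × B)} {a : A} : a ∈ dom s ↔ ∃ b, (a, b) ∈ s := by
  simp [dom]

theorem mem_restrict {U : Finset A} {s : Finset (A × B)} {p : A × B} :
    p ∈ restrict U s ↔ p ∈ s ∧ p.1 ∈ U := by
  simp [restrict]

theorem mem_extend {s : Finset (A × B)} {a : A} {b : B} {p : A × B} :
    p ∈ extend s a b ↔ p = (a, b) ∨ p ∈ s := by
  simp [extend]

/-- The restriction of the bijection `e` to `U`, given by its graph. -/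
def graphOn (e : A ≃ B) (U : Finset A) : Finset (A × B) :=
  U.map ⟨fun a => (a, e a), fun _ _ h => congrArg Prod.fst h⟩

theorem mem_graphOn {e : A ≃ B} {U : Finset A} {p : A × B} :
    p ∈ graphOn e U ↔ p.1 ∈ U ∧ p.2 = e p.1 := by
  simp only [graphOn, Finset.mem_map]
  constructor
  · rintro ⟨a, ha, rfl⟩
    exact ⟨ha, rfl⟩
  · rintro ⟨h1, h2⟩
    exact ⟨p.1, h1, Prod.ext rfl h2.symm⟩

theorem dom_graphOn (e : A ≃ B) (U : Finset A) : dom (graphOn e U) = U := by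
  ext a
  simp [mem_dom, mem_graphOn]

theorem graphOn_dom {e : A ≃ B} {s : Finset (A × B)} (hs : ∀ p ∈ s, p.2 = e p.1) :
    graphOn e (dom s) = s := by
  ext ⟨a, b⟩
  simp only [mem_graphOn, mem_dom]
  constructor
  · rintro ⟨⟨c, hc⟩, rfl⟩
    rwa [← hs _ hc]
  · exact fun h => ⟨⟨b, h⟩, hs _ h⟩

/-- The presheaf of all restrictions of the bijection `e` to sets of at most `k` elements. -/
def restrictions (k : ℕ) (e : A ≃ B) : LowerSet (Finset (A × B)) where
  carrier := {s | (dom s).card ≤ k ∧ ∀ p ∈ s, p.2 = e p.1}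
  lower' := by
    classical
    intro s t hts hs
    have hts : t ⊆ s := hts
    exact ⟨(Finset.card_le_card (Finset.image_subset_image hts)).trans hs.1,
      fun p hp => hs.2 p (hts hp)⟩

theorem mem_inv {s : Finset (A × B)} {b : B} {a : A} : (b, a) ∈ inv s ↔ (a, b) ∈ s := by
  simp [inv]

theorem inv_inv (s : Finset (A × B)) : inv (inv s) = s := by
  ext ⟨a, b⟩
  rw [mem_inv, mem_inv]

theorem card_dom_graph {e : A ≃ B} {s : Finset (A × B)} (hs : ∀ p ∈ s, p.2 = e p.1) :
    (dom s).card = s.card := by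
  conv_rhs => rw [← graphOn_dom hs]
  simp [graphOn]

theorem inv_mem_restrictions {k : ℕ} {e : A ≃ B} {s : Finset (A × B)}
    (hs : s ∈ restrictions k e) : inv s ∈ restrictions k e.symm := by
  have h : ∀ p ∈ inv s, p.2 = e.symm p.1 := by
    rintro ⟨b, a⟩ hp
    exact (e.symm_apply_eq.2 (hs.2 _ (mem_inv.1 hp))).symm
  refine ⟨?_, h⟩
  rw [card_dom_graph h]
  simpa [inv, card_dom_graph hs.2] using hs.1

theorem image_inv_restrictions (k : ℕ) (e : A ≃ B) :
    inv '' (restrictions k e : Set (Finset (A × B))) = restrictions k e.symm := by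
  refine Set.Subset.antisymm ?_ fun s hs => ⟨inv s, inv_mem_restrictions hs, inv_inv s⟩
  rintro _ ⟨s, hs, rfl⟩
  exact inv_mem_restrictions hs

theorem zExt_restrictions {k : ℕ} {e : A ≃ B} {s : Finset (A × B)} (hs : s ∈ restrictions k e) :
    ZExt k (restrictions k e : Set (Finset (A × B))) s := by
  refine ⟨fun U => Finsupp.single (graphOn e U) 1, ⟨fun U hU t ht => ?_, fun U' U h _ => ?_⟩, ?_⟩
  · obtain rfl : t = graphOn e U := by
      simpa using Finsupp.support_single_subset ht
    exact ⟨⟨by rwa [dom_graphOn], fun p hp => (mem_graphOn.1 hp).2⟩, dom_graphOn e U⟩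
  · rw [Finsupp.mapDomain_single]
    congr 1
    ext p
    simp only [mem_restrict, mem_graphOn]
    exact ⟨fun hp => ⟨hp.2, hp.1.2⟩, fun hp => ⟨⟨h hp.1, hp.2⟩, hp.1⟩⟩
  · simp only [graphOn_dom hs.2]

theorem bijForth_restrictions {k : ℕ} {e : A ≃ B} {s : Finset (A × B)}
    (hs : s ∈ restrictions k e) : BijForth k (restrictions k e : Set (Finset (A × B))) s := by
  classical
  refine fun hk => ⟨e, fun a => ⟨?_, fun p hp => ?_⟩⟩
  · have h : dom (extend s a (e a)) ⊆ insert a (dom s) := by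
      intro c hc
      obtain ⟨b, hb⟩ := mem_dom.1 hc
      rcases mem_extend.1 hb with h | h
      · exact Finset.mem_insert.2 (Or.inl (congrArg Prod.fst h))
      · exact Finset.mem_insert_of_mem (mem_dom.2 ⟨b, h⟩)
    exact (Finset.card_le_card h).trans ((Finset.card_insert_le _ _).trans hk)
  · rcases mem_extend.1 hp with rfl | h
    · rfl
    · exact hs.2 p h

theorem cohomEquiv_of_equiv (L : Language) [L.IsRelational] [L.Structure A] [L.Structure B]
    (k : ℕ) (e : L.Equiv A B) : CohomEquiv L k A B := by
  have hle : restrictions k e.toEquiv ≤ localIso L k A B := fun s hs =>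
    { card_le := hs.1
      functional := fun p hp p' hp' h => by rw [hs.2 p hp, hs.2 p' hp', h]
      injective := fun p hp p' hp' h => by
        rw [hs.2 p hp, hs.2 p' hp'] at h
        exact e.toEquiv.injective h
      map_rel := fun R a b h => by
        have hb : b = e ∘ a := funext fun i => hs.2 _ (h i)
        rw [hb]
        exact (e.map_rel R a).symm }
  have hempty : ∅ ∈ restrictions k e.toEquiv := ⟨by simp [dom], by simp⟩
  refine ⟨∅, (isGreatest_greatestFixpoint k _).2 ⟨hle, (refine_le k _).antisymm ?_⟩ hempty⟩
  refine le_sSup ⟨le_rfl, fun s hs => ⟨bijForth_restrictions hs, zExt_restrictions hs, ?_⟩⟩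
  rw [image_inv_restrictions]
  exact zExt_restrictions (inv_mem_restrictions hs)

end OfEquiv

/-! ### Consequences of cohomological equivalence -/

section Fixpoint

variable {A B : Type*}

theorem bijForth_and_zBiExt_of_mem_refine {k : ℕ} {S : LowerSet (Finset (A × B))}
    {s : Finset (A × B)} (hs : s ∈ refine k S) :
    BijForth k (S : Set (Finset (A × B))) s ∧ ZBiExt k (S : Set (Finset (A × B))) s := by
  obtain ⟨T, hT, hsT⟩ := LowerSet.mem_sSup_iff.1 hs
  exact hT.2 s hsT

/-- A cohomological equivalence provides a family of local isomorphisms containing the empty map,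
in which every map has the bijective forth property and the empty map is `ℤ`-extendable. -/
theorem CohomEquiv.exists_lowerSet {L : Language} [L.IsRelational] [L.Structure A]
    [L.Structure B] {k : ℕ} (h : CohomEquiv L k A B) :
    ∃ S : LowerSet (Finset (A × B)), ∅ ∈ S ∧ (∀ s ∈ S, IsLocalIso L k s) ∧
      (∀ s ∈ S, BijForth k (S : Set (Finset (A × B))) s) ∧
      ZExt k (S : Set (Finset (A × B))) ∅ := by
  obtain ⟨s, hs⟩ := h
  have hfix := (isGreatest_greatestFixpoint k (localIso L k A B)).1
  have hempty : ∅ ∈ greatestFixpoint k (localIso L k A B) :=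
    LowerSet.lower _ (Finset.empty_subset s) hs
  have hkey : ∀ t ∈ greatestFixpoint k (localIso L k A B), _ := fun t ht =>
    bijForth_and_zBiExt_of_mem_refine (hfix.2.symm ▸ ht :
      t ∈ refine k (greatestFixpoint k (localIso L k A B)))
  exact ⟨_, hempty, fun t ht => hfix.1 ht, fun t ht => (hkey t ht).1, (hkey ∅ hempty).2.1⟩

open Classical in
/-- Averaging a function on maps with the weights of a global section is compatible with
restriction. -/
theorem IsGlobalSection.sum_eq_sum_restrict {k : ℕ} {S : Set (Finset (A × B))}
    {r : Finset A → (Finset (A × B) →₀ ℤ)} (hr : IsGlobalSection k S r) {U' U : Finset A}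
    (hU : U' ⊆ U) (hk : U.card ≤ k) {M : Type*} [AddCommGroup M] (f : Finset (A × B) → M) :
    ((r U').sum fun s n => n • f s) = (r U).sum fun s n => n • f (restrict U' s) := by
  rw [← hr.compat U' U hU hk]
  exact Finsupp.sum_mapDomain_index (fun _ => zero_smul ℤ _) fun _ _ _ => add_smul _ _ _

/-- A global section through the empty map has total mass `1` on every set. -/
theorem IsGlobalSection.sum_smul_const {k : ℕ} {S : Set (Finset (A × B))}
    {r : Finset A → (Finset (A × B) →₀ ℤ)} (hr : IsGlobalSection k S r)
    (h0 : r ∅ = Finsupp.single ∅ 1) {U : Finset A} (hk : U.card ≤ k) {M : Type*}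
    [AddCommGroup M] (m : M) : ((r U).sum fun _ n => n • m) = m := by
  have := hr.sum_eq_sum_restrict (Finset.empty_subset U) hk fun _ => m
  rw [← this, h0, Finsupp.sum_single_index (zero_smul ℤ m), one_smul]

open Classical in
/-- The value at `a` of a partial function `s` composed with `f`, extended by zero outside the
domain of `s`. -/
noncomputable def valueAt {M : Type*} [AddCommMonoid M] (f : B → M) (s : Finset (A × B)) (a : A) :
    M :=
  ∑ p ∈ s with p.1 = a, f p.2

theorem valueAt_restrict {M : Type*} [AddCommMonoid M] (f : B → M) (s : Finset (A × B)) {a : A}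
    {U : Finset A} (ha : a ∈ U) : valueAt f (restrict U s) a = valueAt f s a := by
  unfold valueAt
  congr 1
  ext p
  simp only [Finset.mem_filter, mem_restrict]
  exact ⟨fun h => ⟨h.1.1, h.2⟩, fun h => ⟨⟨h.1, h.2 ▸ ha⟩, h.2⟩⟩

theorem valueAt_eq {L : Language} [L.IsRelational] [L.Structure A] [L.Structure B] {k : ℕ}
    {M : Type*} [AddCommMonoid M] (f : B → M) {s : Finset (A × B)} (hs : IsLocalIso L k s) {a : A}
    {b : B} (hab : (a, b) ∈ s) : valueAt f s a = f b := by
  classical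
  have : s.filter (fun p => p.1 = a) = {(a, b)} := by
    ext p
    simp only [Finset.mem_filter, Finset.mem_singleton]
    constructor
    · rintro ⟨hp, h⟩
      exact Prod.ext h (hs.functional p hp _ hab h)
    · rintro rfl
      exact ⟨hab, rfl⟩
  unfold valueAt
  convert Finset.sum_singleton (fun p : A × B => f p.2) (a, b)

end Fixpoint

/-! ### Coordinates on CFI structures -/

section Coordinates

variable {V : Type*} [Fintype V] {q : ℕ} {G : SimpleGraph V} [DecidableRel G.Adj]
  {g h : G.edgeSet → ZMod q}

/-- The coordinate at `y` of an element of a CFI structure, with value `0` if `y` is not a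
neighbour of the underlying vertex. -/
def CFI.coord (a : CFI q G g) (y : V) : ZMod q :=
  if hy : G.Adj a.vertex y then a.val.1 ⟨y, hy⟩ else 0

/-- The twist as a function of two vertices, with value `0` on non-edges. -/
def twist (g : G.edgeSet → ZMod q) (x y : V) : ZMod q :=
  if hxy : G.Adj x y then g ⟨s(x, y), hxy⟩ else 0

/-- The zero element of the gadget of `x`. -/
def CFI.zero (g : G.edgeSet → ZMod q) (x : V) : CFI q G g := ⟨x, 0, by simp⟩

theorem CFI.zero_coord (x y : V) : (CFI.zero g x).coord y = 0 := by
  unfold CFI.coord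
  split <;> rfl

theorem sum_neighborSet_eq (x : V) (f : V → ZMod q) (hf : ∀ y, ¬ G.Adj x y → f y = 0) :
    ∑ y : G.neighborSet x, f y = ∑ y, f y := by
  classical
  rw [← Finset.sum_filter_add_sum_filter_not Finset.univ (G.Adj x),
    Finset.sum_eq_zero (s := Finset.univ.filter fun y => ¬ G.Adj x y)
      fun y hy => hf y (Finset.mem_filter.1 hy).2, add_zero]
  exact (Finset.sum_subtype _ (by simp) f).symm

theorem CFI.sum_coord (a : CFI q G g) : ∑ y, a.coord y = 0 := by
  rw [← sum_neighborSet_eq a.vertex a.coord fun y hy => dif_neg hy, ← a.val.2]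
  exact Finset.sum_congr rfl fun y _ => dif_pos y.2

variable [LinearOrder V]

theorem relMap_I (v : Fin 3 → CFI q G g) :
    Language.Structure.RelMap (L := cfiLanguage q) (CFIRel.I : CFIRel q 3) v ↔
      (v 0).vertex = (v 1).vertex ∧ G.Adj (v 0).vertex (v 2).vertex ∧
        (v 0).coord (v 2).vertex = (v 1).coord (v 2).vertex := by
  constructor
  · rintro ⟨x, y, hxy, a, b, c, rfl, he⟩
    simpa [CFI.coord, hxy] using he
  · rintro ⟨h1, h2, h3⟩
    have hv : v = ![v 0, v 1, v 2] := by ext i; fin_cases i <;> rfl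
    generalize v 0 = a at *
    generalize v 1 = b at *
    generalize v 2 = c at *
    obtain ⟨x, a⟩ := a
    obtain ⟨_, b⟩ := b
    obtain ⟨y, c⟩ := c
    cases h1
    exact ⟨x, y, h2, a, b, c, hv, by simpa [CFI.coord, show G.Adj x y from h2] using h3⟩

theorem relMap_C (v : Fin 3 → CFI q G g) :
    Language.Structure.RelMap (L := cfiLanguage q) (CFIRel.C : CFIRel q 3) v ↔
      (v 0).vertex = (v 1).vertex ∧ G.Adj (v 0).vertex (v 2).vertex ∧
        (v 0).coord (v 2).vertex = (v 1).coord (v 2).vertex + 1 := by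
  constructor
  · rintro ⟨x, y, hxy, a, b, c, rfl, he⟩
    simpa [CFI.coord, hxy] using he
  · rintro ⟨h1, h2, h3⟩
    have hv : v = ![v 0, v 1, v 2] := by ext i; fin_cases i <;> rfl
    generalize v 0 = a at *
    generalize v 1 = b at *
    generalize v 2 = c at *
    obtain ⟨x, a⟩ := a
    obtain ⟨_, b⟩ := b
    obtain ⟨y, c⟩ := c
    cases h1
    exact ⟨x, y, h2, a, b, c, hv, by simpa [CFI.coord, show G.Adj x y from h2] using h3⟩

theorem relMap_E (c : ZMod q) (v : Fin 2 → CFI q G g) :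
    Language.Structure.RelMap (L := cfiLanguage q) (CFIRel.E c : CFIRel q 2) v ↔
      G.Adj (v 0).vertex (v 1).vertex ∧
        (v 0).coord (v 1).vertex + (v 1).coord (v 0).vertex =
          c + twist g (v 0).vertex (v 1).vertex := by
  constructor
  · rintro ⟨x, y, hxy, a, b, rfl, he⟩
    simpa [CFI.coord, twist, hxy, hxy.symm] using he
  · rintro ⟨h2, h3⟩
    have hv : v = ![v 0, v 1] := by ext i; fin_cases i <;> rfl
    generalize v 0 = a at *
    generalize v 1 = b at *
    obtain ⟨x, a⟩ := a
    obtain ⟨y, b⟩ := b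
    have h2 : G.Adj x y := h2
    exact ⟨x, y, h2, a, b, hv, by simpa [CFI.coord, twist, h2, h2.symm] using h3⟩

end Coordinates

/-! ### Potentials and isomorphisms -/

section Potential

variable {V : Type*} [Fintype V] {q : ℕ} {G : SimpleGraph V} [DecidableRel G.Adj]

/-- `t` is a potential for `m`: a function on darts, extended by zero to all pairs of vertices,
whose sum at each vertex vanishes and whose values at the two orientations of an edge add up to
`m`. -/
structure IsPotential (G : SimpleGraph V) (m t : V → V → ZMod q) : Prop where
  eq_zero : ∀ x y, ¬ G.Adj x y → t x y = 0
  sum_eq_zero : ∀ x, ∑ y, t x y = 0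
  add_swap : ∀ x y, G.Adj x y → t x y + t y x = m x y

/-- Double counting over darts: a function on edges having a potential has sum zero. -/
theorem IsPotential.sum_edgeSet_eq_zero [DecidableEq V] {m t : V → V → ZMod q}
    (ht : IsPotential G m t) (f : G.edgeSet → ZMod q)
    (hf : ∀ x y (hxy : G.Adj x y), f ⟨s(x, y), hxy⟩ = m x y) : ∑ e, f e = 0 := by
  have h1 : ∑ d : G.Dart, t d.fst d.snd = 0 := by
    rw [← Finset.sum_fiberwise (s := Finset.univ) (g := fun d : G.Dart => d.fst)]
    refine Finset.sum_eq_zero fun x _ => ?_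
    rw [G.dart_fst_fiber, Finset.sum_image fun _ _ _ _ h => G.dartOfNeighborSet_injective x h,
      ← ht.sum_eq_zero x, ← sum_neighborSet_eq x (t x) (ht.eq_zero x)]
    rfl
  rw [← h1, ← Finset.sum_fiberwise (s := Finset.univ)
    (g := fun d : G.Dart => (⟨d.edge, d.edge_mem⟩ : G.edgeSet))]
  refine Finset.sum_congr rfl fun e _ => ?_
  obtain ⟨e, he⟩ := e
  induction e with | _ x y
  have hxy : G.Adj x y := he
  have hfib : (Finset.univ.filter fun d : G.Dart =>
      (⟨d.edge, d.edge_mem⟩ : G.edgeSet) = ⟨s(x, y), he⟩) =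
        {⟨(x, y), hxy⟩, (⟨(x, y), hxy⟩ : G.Dart).symm} := by
    rw [← SimpleGraph.Dart.edge_fiber]
    ext d
    simp only [Finset.mem_filter, Finset.mem_univ, true_and, Subtype.mk.injEq]
    rfl
  rw [hfib, Finset.sum_pair (SimpleGraph.Dart.symm_ne _).symm, hf x y hxy]
  exact (ht.add_swap x y hxy).symm

variable {g h : G.edgeSet → ZMod q}

/-- Translation of every gadget by the corresponding row of `t`. -/
def CFI.shift (h : G.edgeSet → ZMod q) {t : V → V → ZMod q}
    (h0 : ∀ x y, ¬ G.Adj x y → t x y = 0) (hs : ∀ x, ∑ y, t x y = 0) (a : CFI q G g) :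
    CFI q G h :=
  ⟨a.vertex, fun y => a.val.1 y + t a.vertex y, by
    rw [Finset.sum_add_distrib, a.val.2, sum_neighborSet_eq _ _ (h0 _), hs, add_zero]⟩

/-- Translation by a potential for `h - g` is an isomorphism from `CFI q G g` to `CFI q G h`. -/
def equivOfPotential [LinearOrder V] {t : V → V → ZMod q}
    (ht : IsPotential G (fun x y => twist h x y - twist g x y) t) :
    (cfiLanguage q).Equiv (CFI q G g) (CFI q G h) where
  toFun := CFI.shift h ht.eq_zero ht.sum_eq_zero
  invFun := CFI.shift g (t := fun x y => -t x y) (fun x y hxy => by simp [ht.eq_zero x y hxy])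
    (fun x => by simp [ht.sum_eq_zero x])
  left_inv a := by simp [CFI.shift]; rfl
  right_inv a := by simp [CFI.shift]; rfl
  map_fun' f := nomatch f
  map_rel' := by
    have hc : ∀ (a : CFI q G g) (y : V), G.Adj a.vertex y →
        (CFI.shift h ht.eq_zero ht.sum_eq_zero a).coord y = a.coord y + t a.vertex y := by
      intro a y hy
      simp [CFI.coord, CFI.shift, hy]
    have hv : ∀ a : CFI q G g,
      (CFI.shift h ht.eq_zero ht.sum_eq_zero a).vertex = a.vertex := fun _ => rfl
    intro n R v
    cases R with
    | prec => exact Iff.rfl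
    | I =>
      refine (relMap_I _).trans (Iff.trans ?_ (relMap_I _).symm)
      simp only [Function.comp_apply, hv]
      refine and_congr_right fun h1 => and_congr_right fun h2 => ?_
      rw [hc _ _ h2, hc _ _ (h1 ▸ h2), h1, add_left_inj]
    | C =>
      refine (relMap_C _).trans (Iff.trans ?_ (relMap_C _).symm)
      simp only [Function.comp_apply, hv]
      refine and_congr_right fun h1 => and_congr_right fun h2 => ?_
      rw [hc _ _ h2, hc _ _ (h1 ▸ h2), h1, add_right_comm, add_left_inj]
    | E c =>
      refine (relMap_E c _).trans (Iff.trans ?_ (relMap_E c _).symm)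
      simp only [Function.comp_apply, hv]
      refine and_congr_right fun h2 => ?_
      have := ht.add_swap _ _ h2
      rw [hc _ _ h2, hc _ _ h2.symm, add_add_add_comm, this]
      constructor <;> intro heq <;> linear_combination heq

end Potential

/-! ### A potential from a cohomological equivalence -/

section Predecessors

variable {V : Type*} [Fintype V] [LinearOrder V] {q : ℕ} {G : SimpleGraph V} [DecidableRel G.Adj]
  {g : G.edgeSet → ZMod q}

instance [NeZero q] : Finite (CFI q G g) := by
  have (x : V) : Finite (Gadget q G x) := Subtype.finite
  exact Finite.of_injective (fun a : CFI q G g => (⟨a.vertex, a.val⟩ : Σ x, Gadget q G x)) <| by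
    rintro ⟨x, a⟩ ⟨y, b⟩ hab
    cases hab
    rfl

/-- The number of elements of `CFI q G g` that lie in gadgets of vertices smaller than `x`. -/
noncomputable def predecessorCount (g : G.edgeSet → ZMod q) (x : V) : ℕ :=
  {a : CFI q G g | a.vertex < x}.ncard

theorem predecessorCount_strictMono [NeZero q] : StrictMono (predecessorCount g) := by
  intro x y hxy
  -- The zero element of the gadget of `x` precedes `y` but not `x`.
  refine Set.ncard_lt_ncard ⟨fun a ha => lt_trans ha hxy, fun hsub => ?_⟩ (Set.toFinite _)
  exact lt_irrefl x (hsub (show (CFI.zero g x).vertex < y from hxy))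

end Predecessors

section Equivalence

variable {V W : Type*} [Fintype V] [LinearOrder V] [Fintype W] [LinearOrder W] {q : ℕ}
  {G : SimpleGraph V} [DecidableRel G.Adj] {H : SimpleGraph W} [DecidableRel H.Adj]
  {g : G.edgeSet → ZMod q} {h : H.edgeSet → ZMod q}

theorem vertex_lt_iff {k : ℕ} {s : Finset (CFI q G g × CFI q H h)}
    (hs : IsLocalIso (cfiLanguage q) k s) {a c : CFI q G g} {b d : CFI q H h} (hab : (a, b) ∈ s)
    (hcd : (c, d) ∈ s) : a.vertex < c.vertex ↔ b.vertex < d.vertex :=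
  hs.map_rel (n := 2) (CFIRel.prec : CFIRel q 2) ![a, c] ![b, d] fun i => by
    fin_cases i
    exacts [hab, hcd]

/-- On a map defined at two elements `a`, `c`, the relations `R_{E,e}` preserve adjacency, and the
edge sums of the two sides differ by the difference of the twists. -/
theorem adj_iff {k : ℕ} {s : Finset (CFI q G g × CFI q H h)}
    (hs : IsLocalIso (cfiLanguage q) k s) {a c : CFI q G g} {b d : CFI q H h} (hab : (a, b) ∈ s)
    (hcd : (c, d) ∈ s) (e : ZMod q) :
    (G.Adj a.vertex c.vertex ∧
      a.coord c.vertex + c.coord a.vertex = e + twist g a.vertex c.vertex) ↔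
    (H.Adj b.vertex d.vertex ∧
      b.coord d.vertex + d.coord b.vertex = e + twist h b.vertex d.vertex) := by
  have := hs.map_rel (n := 2) (CFIRel.E e : CFIRel q 2) ![a, c] ![b, d] fun i => by
    fin_cases i
    exacts [hab, hcd]
  exact (relMap_E e _).symm.trans (this.trans (relMap_E e _))

/-- Counting `≺`-predecessors along the bijection of the forth property. -/
theorem predecessorCount_eq {S : LowerSet (Finset (CFI q G g × CFI q H h))}
    (hS : ∀ s ∈ S, IsLocalIso (cfiLanguage q) 2 s)
    (hforth : ∀ s ∈ S, BijForth 2 (S : Set (Finset (CFI q G g × CFI q H h))) s)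
    {s : Finset (CFI q G g × CFI q H h)} (hs : s ∈ S) {a : CFI q G g} {b : CFI q H h}
    (hab : (a, b) ∈ s) : predecessorCount g a.vertex = predecessorCount h b.vertex := by
  have hsub : ({(a, b)} : Finset (CFI q G g × CFI q H h)) ∈ S :=
    S.lower (Finset.singleton_subset_iff.2 hab) hs
  obtain ⟨β, hβ⟩ := hforth _ hsub (by simp [dom])
  unfold predecessorCount
  rw [← Set.ncard_image_of_injective _ β.injective]
  congr 1
  rw [Equiv.image_eq_preimage_symm]
  ext d
  have := vertex_lt_iff (hS _ (hβ (β.symm d))) (mem_extend.2 (Or.inl rfl))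
    (mem_extend.2 (Or.inr (Finset.mem_singleton_self (a, b))))
  rwa [β.apply_symm_apply] at this

/-- All maps of a family as provided by a cohomological equivalence induce one and the same
isomorphism of ordered graphs on the underlying vertices. -/
theorem exists_vertex_iso [NeZero q] {S : LowerSet (Finset (CFI q G g × CFI q H h))}
    (hempty : ∅ ∈ S) (hS : ∀ s ∈ S, IsLocalIso (cfiLanguage q) 2 s)
    (hforth : ∀ s ∈ S, BijForth 2 (S : Set (Finset (CFI q G g × CFI q H h))) s) :
    ∃ φ : V ≃o W, (∀ x y, G.Adj x y ↔ H.Adj (φ x) (φ y)) ∧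
      ∀ s ∈ S, ∀ p ∈ s, p.2.vertex = φ p.1.vertex := by
  have hcount := fun s hs p hp => predecessorCount_eq hS hforth (s := s) hs (a := Prod.fst p)
    (b := Prod.snd p) hp
  obtain ⟨β, hβ⟩ := hforth ∅ hempty (by simp [dom])
  have hβ' : ∀ a, predecessorCount g a.vertex = predecessorCount h (β a).vertex := fun a =>
    hcount _ (hβ a) (a, β a) (mem_extend.2 (Or.inl rfl))
  have hmono : StrictMono fun x => (β (CFI.zero g x)).vertex := fun x y hxy => by
    refine (predecessorCount_strictMono (g := h)).lt_iff_lt.1 ?_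
    rw [← hβ', ← hβ']
    exact predecessorCount_strictMono hxy
  have hvert : ∀ s ∈ S, ∀ p ∈ s, p.2.vertex = (β (CFI.zero g p.1.vertex)).vertex :=
    fun s hs p hp => (predecessorCount_strictMono (g := h)).injective <| by
      rw [← hcount s hs p hp, ← hβ']
      rfl
  have hsurj : Function.Surjective fun x => (β (CFI.zero g x)).vertex := fun w => by
    have := hvert _ (hβ (β.symm (CFI.zero h w))) _ (mem_extend.2 (Or.inl rfl))
    rw [β.apply_symm_apply] at this
    exact ⟨_, this.symm⟩
  refine ⟨hmono.orderIsoOfSurjective _ hsurj, fun x y => ?_, hvert⟩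
  obtain ⟨γ, hγ⟩ := hforth _ (hβ (CFI.zero g x)) (by simp [dom, extend])
  have hadj := adj_iff (hS _ (hγ (CFI.zero g y)))
    (mem_extend.2 (Or.inr (mem_extend.2 (Or.inl rfl)))) (mem_extend.2 (Or.inl rfl))
  have hy := hvert _ (hγ (CFI.zero g y)) _ (mem_extend.2 (Or.inl rfl))
  simp only at hy
  simp only [hy] at hadj
  -- For a suitable `e` the relation `R_{E,e}` holds as soon as the two vertices are adjacent.
  exact ⟨fun hxy => ((hadj _).1 ⟨hxy, (sub_add_cancel _ _).symm⟩).1,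
    fun hxy => ((hadj _).2 ⟨hxy, (sub_add_cancel _ _).symm⟩).1⟩

/-- The potential is the average, with the integer weights of a global section, of the images of
the zero elements of the gadgets. -/
theorem exists_potential_of_cohomEquiv [NeZero q]
    (hequiv : CohomEquiv (cfiLanguage q) 2 (CFI q G g) (CFI q H h)) :
    ∃ (φ : V ≃o W) (t : V → V → ZMod q), (∀ x y, G.Adj x y ↔ H.Adj (φ x) (φ y)) ∧
      IsPotential G (fun x y => twist h (φ x) (φ y) - twist g x y) t := by
  classical
  obtain ⟨S, hempty, hS, hforth, r, hr, hr0⟩ := hequiv.exists_lowerSet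
  obtain ⟨φ, hadj, hφ⟩ := exists_vertex_iso hempty hS hforth
  have hr0 : r ∅ = Finsupp.single ∅ 1 := by simpa [dom] using hr0
  let z : V → CFI q G g := CFI.zero g
  -- On the support of `r U`, a map is defined at each point of `U`.
  have hval : ∀ U : Finset (CFI q G g), U.card ≤ 2 → ∀ s ∈ (r U).support, ∀ x, z x ∈ U →
      ∃ b, (z x, b) ∈ s ∧ b.vertex = φ x ∧
        ∀ y, valueAt (fun b : CFI q H h => b.coord (φ y)) s (z x) = b.coord (φ y) := by
    intro U hU s hs x hx
    obtain ⟨hsS, hdom⟩ := hr.mem U hU s hs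
    obtain ⟨b, hb⟩ := mem_dom.1 (hdom ▸ hx)
    exact ⟨b, hb, hφ s hsS _ hb, fun y => valueAt_eq _ (hS s hsS) hb⟩
  let t : V → V → ZMod q := fun x y =>
    (r {z x}).sum fun s n => n • valueAt (fun b : CFI q H h => b.coord (φ y)) s (z x)
  have ht : ∀ U : Finset (CFI q G g), U.card ≤ 2 → ∀ x y, z x ∈ U → t x y =
      (r U).sum fun s n => n • valueAt (fun b : CFI q H h => b.coord (φ y)) s (z x) := by
    intro U hU x y hx
    refine (hr.sum_eq_sum_restrict (Finset.singleton_subset_iff.2 hx) hU _).trans ?_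
    simp only [valueAt_restrict _ _ (Finset.mem_singleton_self (z x))]
  refine ⟨φ, t, hadj, fun x y hxy => ?_, fun x => ?_, fun x y hxy => ?_⟩
  · refine Finset.sum_eq_zero fun s hs => ?_
    obtain ⟨b, -, hb, hv⟩ := hval {z x} (by simp) s hs x (by simp)
    have : ¬ H.Adj b.vertex (φ y) := by rwa [hb, ← hadj]
    have h0 : b.coord (φ y) = 0 := dif_neg this
    simp only [hv, h0, smul_zero]
  · simp only [t, Finsupp.sum]
    rw [Finset.sum_comm]
    refine Finset.sum_eq_zero fun s hs => ?_
    obtain ⟨b, -, hb, hv⟩ := hval {z x} (by simp) s hs x (by simp)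
    rw [← Finset.smul_sum]
    simp only [hv]
    have h0 : ∑ y, b.coord (φ y) = 0 := (φ.toEquiv.sum_comp b.coord).trans b.sum_coord
    rw [h0, smul_zero]
  · have hU : ({z x, z y} : Finset (CFI q G g)).card ≤ 2 := Finset.card_le_two
    rw [ht _ hU x y (by simp), ht _ hU y x (by simp), ← Finsupp.sum_add,
      ← hr.sum_smul_const hr0 hU (twist h (φ x) (φ y) - twist g x y)]
    refine Finset.sum_congr rfl fun s hs => ?_
    obtain ⟨b, hb, hbv, hbc⟩ := hval _ hU s hs x (by simp)
    obtain ⟨d, hd, hdv, hdc⟩ := hval _ hU s hs y (by simp)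
    simp only [hbc, hdc, ← smul_add]
    -- The two zero elements are related by `R_{E,e}` with `e = -g {x, y}`.
    have hE := ((adj_iff (hS s (hr.mem _ hU s hs).1) hb hd (-twist g x y)).1
      ⟨hxy, by rw [CFI.zero_coord, CFI.zero_coord, add_zero]; exact (neg_add_cancel _).symm⟩).2
    rw [hbv, hdv] at hE
    rw [hE, neg_add_eq_sub]

end Equivalence

end CohomWL

open FirstOrder CohomWL in
theorem theorem2 :
    ∃ k : ℕ, ∀ q : ℕ, IsPrimePow q →
      (∀ (V : Type u) [Fintype V] [LinearOrder V] (G : SimpleGraph V) [DecidableRel G.Adj]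
          (g h : G.edgeSet → ZMod q), ∑ e, g e = 0 →
          (CohomEquiv (cfiLanguage q) k (CFI q G g) (CFI q G h) ↔
            Nonempty ((cfiLanguage q).Equiv (CFI q G g) (CFI q G h)))) ∧
      (∀ (V W : Type u) [Fintype V] [LinearOrder V] [Fintype W] [LinearOrder W]
          (G : SimpleGraph V) [DecidableRel G.Adj] (H : SimpleGraph W) [DecidableRel H.Adj]
          (g : G.edgeSet → ZMod q) (h : H.edgeSet → ZMod q),
          ∑ e, g e = 0 → ∑ e, h e ≠ 0 →
          ¬ CohomEquiv (cfiLanguage q) k (CFI q G g) (CFI q H h)) := by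
  refine ⟨2, fun q hq => ?_⟩
  have : NeZero q := ⟨hq.pos.ne'⟩
  refine ⟨fun V _ _ G _ g h _ => ⟨fun hequiv => ?_, fun ⟨e⟩ => cohomEquiv_of_equiv _ 2 e⟩,
    fun V W _ _ _ _ G _ H _ g h hg hh hequiv => hh ?_⟩
  · obtain ⟨φ, t, -, ht⟩ := exists_potential_of_cohomEquiv hequiv
    -- A finite linear order has no automorphism but the identity.
    obtain rfl : φ = OrderIso.refl V := Subsingleton.elim _ _
    exact ⟨equivOfPotential ht⟩
  · obtain ⟨φ, t, hadj, ht⟩ := exists_potential_of_cohomEquiv hequiv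
    let ψ : G ≃g H := ⟨φ.toEquiv, fun {x y} => (hadj x y).symm⟩
    have hsum := ht.sum_edgeSet_eq_zero (fun e => h (ψ.mapEdgeSet e) - g e) fun x y hxy => by
      have : H.Adj (φ x) (φ y) := (hadj x y).1 hxy
      simp only [twist, this, hxy, dif_pos]
      rfl
    rw [Finset.sum_sub_distrib, hg, sub_zero, ψ.mapEdgeSet.sum_comp h] at hsum
    exact hsum
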